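/- Let $p(z)=a_dz^d+\dots+a_1z+a_0\in\mathbb{Z}[z]$ with $d\ge 1$ and $a_d>0$, and suppose that $2\mid p(1)p(2)$. For real $a,b$ let $[a,b]$ denote the set of positive integers $n$ with $a\le n\le b$ (the empty set if $a>b$); a monochromatic solution of $x+y=p(z)$ in a 2-colouring of $[a,b]$ is a triple $x,y,z\in[a,b]$, not necessarily distinct, of the same colour with $x+y=p(z)$. (1) There is a function $\varepsilon:\mathbb{N}\to\mathbb{R}$, depending only on $p$, with $\varepsilon(N)\to 0$ as $N\to\infty$, such that for all sufficiently large $N$ every 2-colouring of $[N,N^{d^3+\varepsilon(N)}]$ contains a monochromatic solution of $x+y=p(z)$. (2) There is a constant $c>0$, depending only on $p$, such that for every positive integer $N$ there is a 2-colouring of $[N,cN^{d^2}]$ without a monochromatic solution of $x+y=p(z)$. -/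

import Mathlib

open Filter Topology Polynomial

/-- The integer interval `[a, b]` with real endpoints, as a set of natural numbers. -/
def natInterval (a b : ℝ) : Set ℕ := {n : ℕ | a ≤ (n : ℝ) ∧ (n : ℝ) ≤ b}

/-- The 2-colouring `φ` of the set `S` admits a monochromatic solution of `x + y = p(z)`:
all of `x, y, z` lie in `S` and receive the same colour. -/
def HasMonoSolution (p : ℤ[X]) {S : Set ℕ} (φ : S → Fin 2) : Prop :=
  ∃ x y z : S, φ x = φ y ∧ φ y = φ z ∧
    ((x : ℕ) : ℤ) + ((y : ℕ) : ℤ) = p.eval ((z : ℕ) : ℤ)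

/-! In a solution-free colouring, `x ↦ p(z) - x` sends points coloured like `z` to the other colour.
If `z`, `z + 1` differ, composing their reflections shifts the class of `z` into itself by `s =
p(z+1) - p(z)`. An opposite change at `w` shifts the same class by `-t`, with `t = p(w+1) - p(w)`.
On a window of length `s + t` the two shifts form a rotation, which finiteness makes reversible, so
the colouring is `s`-invariant. Since `p(z)` or `p(z+1)` is even, its half then yields a solution.

Both colours occur below `O(N^d)`. For `d ≥ 2`, one change at `z` there forces an opposite pair just
below `p(z) = O(N^(d^2))`, and using that pair needs values up to `O(N^(d^3))`. For `d = 1`, two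
successive scales supply the pair.

For (2), cutting the interval at `N^d / 4` avoids solutions. -/

/-- The colouring `χ` has no monochromatic solution of `x + y = f z` inside `[N, M]`. -/
def IsSolutionFree (f : ℤ → ℤ) (N M : ℤ) (χ : ℤ → Fin 2) : Prop :=
  ∀ x y z, N ≤ x → x ≤ M → N ≤ y → y ≤ M → N ≤ z → z ≤ M →
    x + y = f z → χ x = χ y → χ y ≠ χ z

/-! ### Reflections, shifts and opposite colour changes -/

theorem Fin.eq_of_ne_of_ne_two {a b c : Fin 2} (h₁ : a ≠ c) (h₂ : b ≠ c) : a = b := by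
  omega

theorem IsSolutionFree.reflect_ne {f : ℤ → ℤ} {N M : ℤ} {χ : ℤ → Fin 2}
    (h : IsSolutionFree f N M χ) {x z : ℤ} (hx : N ≤ x) (hx' : x ≤ M) (hz : N ≤ z) (hz' : z ≤ M)
    (hy : N ≤ f z - x) (hy' : f z - x ≤ M) (hc : χ x = χ z) : χ (f z - x) ≠ χ z := by
  intro hcy
  exact h x (f z - x) z hx hx' hy hy' hz hz' (by ring) (hc.trans hcy.symm) hcy

/-- Reflecting in `f z` and then in `f w`, where `z` and `w` have different colours, preserves the
colour of `z`. -/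
theorem IsSolutionFree.shift_eq {f : ℤ → ℤ} {N M : ℤ} {χ : ℤ → Fin 2}
    (h : IsSolutionFree f N M χ) {x z w : ℤ} (hx : N ≤ x) (hx' : x ≤ M)
    (hz : N ≤ z) (hz' : z ≤ M) (hw : N ≤ w) (hw' : w ≤ M) (hzw : χ w ≠ χ z)
    (hy : N ≤ f z - x) (hy' : f z - x ≤ M)
    (hv : N ≤ x + (f w - f z)) (hv' : x + (f w - f z) ≤ M)
    (hc : χ x = χ z) : χ (x + (f w - f z)) = χ z := by
  have h1 := h.reflect_ne hx hx' hz hz' hy hy' hc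
  have e : f w - (f z - x) = x + (f w - f z) := by ring
  have h2 := h.reflect_ne hy hy' hw hw' (by rw [e]; exact hv) (by rw [e]; exact hv')
    (Fin.eq_of_ne_of_ne_two h1 hzw)
  rw [e] at h2
  exact Fin.eq_of_ne_of_ne_two h2 hzw.symm

/-- A property of the integers in a window of length `s + t` that is preserved by the rotation
`x ↦ x + s` or `x - t` of the window is also preserved by its inverse. -/
theorem of_rotation_window {P : ℤ → Prop} {a s t : ℤ}
    (h₁ : ∀ x, a ≤ x → x < a + t → P x → P (x + s))
    (h₂ : ∀ x, a + t ≤ x → x < a + s + t → P x → P (x - t))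
    (hs : 0 < s) {x : ℤ} (hx : a ≤ x) (hx' : x < a + t) (hP : P (x + s)) : P x := by
  classical
  let S := (Finset.Ico a (a + s + t)).filter P
  let g : ℤ → ℤ := fun x => if x < a + t then x + s else x - t
  have hmaps : ∀ y ∈ S, g y ∈ S := by
    intro y hy
    simp only [S, Finset.mem_filter, Finset.mem_Ico, g] at hy ⊢
    split_ifs with hlt
    · exact ⟨⟨by omega, by omega⟩, h₁ y hy.1.1 hlt hy.2⟩
    · exact ⟨⟨by omega, by omega⟩, h₂ y (by omega) hy.1.2 hy.2⟩
  have hinj : Set.InjOn g S := by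
    intro y hy w hw hyw
    simp only [S, Finset.coe_filter, Finset.mem_Ico, Set.mem_ofPred_eq] at hy hw
    simp only [g] at hyw
    split_ifs at hyw <;> omega
  -- An injective self-map of a finite set is onto, so `x + s` has a preimage in `S`.
  have himg : S.image g = S := by
    apply Finset.eq_of_subset_of_card_le
    · intro w hw
      obtain ⟨y, hy, rfl⟩ := Finset.mem_image.1 hw
      exact hmaps y hy
    · rw [Finset.card_image_of_injOn hinj]
  have hmem : x + s ∈ S.image g := by
    rw [himg]
    simp only [S, Finset.mem_filter, Finset.mem_Ico]
    exact ⟨⟨by omega, by omega⟩, hP⟩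
  obtain ⟨y, hy, hgy⟩ := Finset.mem_image.1 hmem
  simp only [S, Finset.mem_filter, Finset.mem_Ico] at hy
  simp only [g] at hgy
  split_ifs at hgy
  · obtain rfl : y = x := by omega
    exact hy.2
  · omega

/-- Two colour changes in opposite directions, close to each other relative to the growth of `f`,
force a monochromatic solution. -/
theorem IsSolutionFree.false_of_opposite_switches {f : ℤ → ℤ} {N M : ℤ} {χ : ℤ → Fin 2}
    (h : IsSolutionFree f N M χ) {z w : ℤ} (hpar : Even (f z) ∨ Even (f (z + 1)))
    (hN : 0 ≤ N) (hz : N ≤ z) (hzw : z ≤ w) (hw : w + 1 ≤ M)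
    (hs : f z < f (z + 1)) (ht : f w < f (w + 1)) (hm : f z ≤ f w) (hm' : f (z + 1) ≤ f (w + 1))
    (hM : f (w + 1) ≤ M)
    (hsize : 2 * N + 2 * (f (z + 1) - f z) + 2 * (f (w + 1) - f w) ≤ f z)
    (hz1 : χ (z + 1) ≠ χ z) (hw0 : χ w ≠ χ z) (hw1 : χ (w + 1) = χ z) : False := by
  obtain ⟨s, hsdef⟩ : ∃ s, s = f (z + 1) - f z := ⟨_, rfl⟩
  obtain ⟨t, htdef⟩ : ∃ t, t = f (w + 1) - f w := ⟨_, rfl⟩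
  have up : ∀ x, N ≤ x → x ≤ f z - N → χ x = χ z → χ (x + s) = χ z := by
    intro x hx hx' hc
    rw [hsdef]
    exact h.shift_eq hx (by omega) hz (by omega) (by omega) (by omega) hz1 (by omega) (by omega)
      (by omega) (by omega) hc
  have down : ∀ x, N + t ≤ x → x ≤ f z - N → χ x = χ z → χ (x - t) = χ z := by
    intro x hx hx' hc
    have := h.shift_eq (x := x) (z := w + 1) (w := w) (by omega) (by omega) (by omega) (by omega)
      (by omega) (by omega) (by rw [hw1]; exact hw0) (by omega) (by omega) (by omega) (by omega)
      (by rw [hw1]; exact hc)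
    rw [hw1] at this
    rw [← this, htdef]
    congr 1
    ring
  have key : ∀ a, N ≤ a → a + s + t ≤ f z - N → χ (a + s) = χ z → χ a = χ z := by
    intro a ha ha' hc
    exact of_rotation_window (P := fun x => χ x = χ z) (a := a) (s := s) (t := t)
      (fun x h1 h2 => up x (by omega) (by omega)) (fun x h1 h2 => down x (by omega) (by omega))
      (by omega) le_rfl (by omega) hc
  -- Half of the even value cannot share the colour of its argument. Invariance under `s` carries
  -- this to a solution at the other of `z`, `z + 1`.
  rcases hpar with ⟨x, hx⟩ | ⟨x, hx⟩
  · have hxz : χ x ≠ χ z := fun hc =>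
      h x x z (by omega) (by omega) (by omega) (by omega) hz (by omega) hx.symm rfl hc
    have hxs : χ (x + s) ≠ χ z := fun hc => hxz (key x (by omega) (by omega) hc)
    exact h x (x + s) (z + 1) (by omega) (by omega) (by omega) (by omega) (by omega) (by omega)
      (by omega) (Fin.eq_of_ne_of_ne_two hxz hxs) (Fin.eq_of_ne_of_ne_two hxs hz1)
  · have hxz : χ x = χ z := by
      have : χ x ≠ χ (z + 1) := fun hc =>
        h x x (z + 1) (by omega) (by omega) (by omega) (by omega) (by omega) (by omega)
          hx.symm rfl hc
      exact Fin.eq_of_ne_of_ne_two this hz1.symm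
    have hxs : χ (x - s) = χ z := key (x - s) (by omega) (by omega) (by simpa using hxz)
    exact h x (x - s) z (by omega) (by omega) (by omega) (by omega) (by omega) (by omega)
      (by omega) (hxz.trans hxs.symm) hxs

/-! ### Finding colour changes -/

theorem exists_switch {χ : ℤ → Fin 2} {x y : ℤ} (hxy : x ≤ y) (hc : χ y ≠ χ x) :
    ∃ z, x ≤ z ∧ z + 1 ≤ y ∧ χ z = χ x ∧ χ (z + 1) ≠ χ x := by
  by_contra! H
  have : ∀ n : ℤ, x ≤ n → n ≤ y → χ n = χ x := by
    intro n hn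
    induction n, hn using Int.leInduction with
    | base => intro _; rfl
    | succ n hn ih => intro h; exact H n hn h (ih (by omega))
  exact hc (this y hxy le_rfl)

theorem exists_opposite_switches {χ : ℤ → Fin 2} {x y w : ℤ} (hxy : x ≤ y) (hyw : y ≤ w)
    (hc : χ y ≠ χ x) (hc' : χ w = χ x) :
    ∃ z₁ z₂, x ≤ z₁ ∧ z₁ ≤ z₂ ∧ z₂ + 1 ≤ w ∧ χ (z₁ + 1) ≠ χ z₁ ∧ χ z₂ ≠ χ z₁ ∧
      χ (z₂ + 1) = χ z₁ := by
  obtain ⟨z₁, h1, h2, h3, h4⟩ := exists_switch hxy hc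
  obtain ⟨z₂, g1, g2, g3, g4⟩ := exists_switch (χ := χ) hyw (by rw [hc']; exact hc.symm)
  refine ⟨z₁, z₂, h1, by omega, g2, by rwa [h3], by rwa [g3, h3], ?_⟩
  rw [h3]
  exact Fin.eq_of_ne_of_ne_two g4 hc.symm

/-- Every long enough interval `[u, C (5u)^d]` sees both colours. -/
theorem IsSolutionFree.exists_ne {f : ℤ → ℤ} {N M : ℤ} {χ : ℤ → Fin 2}
    (h : IsSolutionFree f N M χ) {d : ℕ} (hd : 1 ≤ d) {C u : ℤ} (hC : 1 ≤ C) (hu : 1 ≤ u)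
    (hNu : N ≤ u) (hM : C * (5 * u) ^ d ≤ M) (hlow : ∀ x, u ≤ x → x ^ d ≤ 2 * f x)
    (hup : ∀ x, 1 ≤ x → f x ≤ C * x ^ d) (hpar : ∀ x, Even (f x) ∨ Even (f (x + 1))) :
    ∃ x y, u ≤ x ∧ x ≤ C * (5 * u) ^ d ∧ u ≤ y ∧ y ≤ C * (5 * u) ^ d ∧ χ x ≠ χ y := by
  -- With `f v = 2 * x`, the points `x` and `v` differ in colour; `v ≥ 4 * u` ensures `x ≥ v / 4 ≥
  -- u`.
  obtain ⟨v, hv, hv', x, hx⟩ : ∃ v, 4 * u ≤ v ∧ v ≤ 4 * u + 1 ∧ Even (f v) := by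
    rcases hpar (4 * u) with hp | hp
    · exact ⟨4 * u, le_rfl, by omega, hp⟩
    · exact ⟨4 * u + 1, by omega, le_rfl, hp⟩
  have h1 : v ≤ v ^ d := le_self_pow₀ (by omega) (by omega)
  have h2 : v ^ d ≤ (5 * u) ^ d := pow_le_pow_left₀ (by omega) (by omega) d
  have h3 := hlow v (by omega)
  have h4 := hup v (by omega)
  have h5 : C * v ^ d ≤ C * (5 * u) ^ d := mul_le_mul_of_nonneg_left h2 (by omega)
  have h6 : (5 * u) ^ d ≤ C * (5 * u) ^ d := le_mul_of_one_le_left (by positivity) hC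
  refine ⟨x, v, by omega, by omega, by omega, by omega, fun hc => ?_⟩
  exact h x x v (by omega) (by omega) (by omega) (by omega) (by omega) (by omega) hx.symm rfl hc

/-- Below `f z`, a single colour change at `z` propagates to changes in both directions. -/
theorem IsSolutionFree.exists_opposite_of_switch {f : ℤ → ℤ} {N M : ℤ} {χ : ℤ → Fin 2}
    (h : IsSolutionFree f N M χ) {z : ℤ} (hN : 0 ≤ N) (hz : N ≤ z) (hz' : z + 1 ≤ M)
    (hs : f z < f (z + 1)) (hM : f (z + 1) ≤ M) (hsize : 4 * (f (z + 1) - f z) + 2 * z ≤ f z)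
    (hc : χ (z + 1) ≠ χ z) :
    ∃ z₁ z₂, f z - z - 2 * (f (z + 1) - f z) ≤ z₁ ∧ z₁ ≤ z₂ ∧ z₂ + 1 ≤ f z ∧
      χ (z₁ + 1) ≠ χ z₁ ∧ χ z₂ ≠ χ z₁ ∧ χ (z₂ + 1) = χ z₁ := by
  obtain ⟨s, hsdef⟩ : ∃ s, s = f (z + 1) - f z := ⟨_, rfl⟩
  rw [← hsdef] at hsize ⊢
  have hk0 : ∀ k : ℕ, (0 : ℤ) ≤ k * s := fun k => mul_nonneg (by positivity) (by omega)
  have up : ∀ k : ℕ, z + k * s ≤ f z - N → χ (z + k * s) = χ z := by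
    intro k
    induction k with
    | zero => simp
    | succ k ih =>
      intro hk
      have h0 := hk0 k
      push_cast at hk ⊢
      rw [add_mul, one_mul] at hk ⊢
      have := h.shift_eq (x := z + k * s) (z := z) (w := z + 1) (by omega) (by omega) hz (by omega)
        (by omega) hz' hc (by omega) (by omega) (by omega) (by omega) (ih (by omega))
      rw [← hsdef] at this
      rw [← add_assoc]
      exact this
  have down : ∀ k : ℕ, z + k * s ≤ f z - N → χ (f z - (z + k * s)) ≠ χ z := fun k hk => by
    have h0 := hk0 k
    exact h.reflect_ne (by omega) (by omega) hz (by omega) (by omega) (by omega) (up k hk)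
  have b1 := down 1 (by push_cast; omega)
  have b2 := down 2 (by push_cast; omega)
  push_cast at b1 b2
  -- A term of the progression from `z`, coloured like `z`, falls between the two reflected points
  -- of `b1` and `b2`, which have the other colour.
  obtain ⟨k, hk1, hk2⟩ : ∃ k : ℕ, z + k * s ≤ f z - z - s - 1 ∧
      f z - z - s - 1 < z + k * s + s := by
    refine ⟨((f z - z - s - 1 - z) / s).toNat, ?_⟩
    rw [Int.toNat_of_nonneg (Int.ediv_nonneg (by omega) (by omega))]
    have e1 := Int.mul_ediv_add_emod (f z - z - s - 1 - z) s
    have e2 := Int.emod_nonneg (f z - z - s - 1 - z) (b := s) (by omega)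
    have e3 := Int.emod_lt_of_pos (f z - z - s - 1 - z) (b := s) (by omega)
    rw [mul_comm] at e1
    constructor <;> omega
  have hr := up k (by omega)
  obtain ⟨z₁, z₂, g1, g2, g3, g4⟩ := exists_opposite_switches (χ := χ)
    (x := f z - (z + 2 * s)) (y := z + k * s) (w := f z - (z + 1 * s)) (by omega) (by omega)
    (by rw [hr]; exact b2.symm) (Fin.eq_of_ne_of_ne_two b1 b2)
  exact ⟨z₁, z₂, by omega, g2, by omega, g4⟩

/-! ### The upper bound for functions of polynomial growth -/

/-- A function growing like a polynomial of degree `d`, with an even value at one of any two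
consecutive integers, admits monochromatic solutions of `x + y = f z` in `[N, O(N ^ d ^ 3)]`. -/
theorem exists_not_isSolutionFree {f : ℤ → ℤ} {d : ℕ} (hd : 1 ≤ d) {C : ℤ} (hC : 1 ≤ C)
    (hlow : ∀ᶠ x in atTop, x ^ d ≤ 2 * f x) (hup : ∀ x, 1 ≤ x → f x ≤ C * x ^ d)
    (hinc : ∀ᶠ x in atTop, f x < f (x + 1))
    (hdiff : ∀ K : ℤ, ∀ᶠ x in atTop, K * (f (x + 1) - f x) ≤ f x)
    (hpar : ∀ x, Even (f x) ∨ Even (f (x + 1))) :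
    ∀ᶠ N : ℤ in atTop, ∀ χ : ℤ → Fin 2,
      ¬ IsSolutionFree f N (C * (C * (C * (200 * N) ^ d) ^ d) ^ d) χ := by
  obtain ⟨R, hR⟩ : ∃ R, R = 200 * C ^ 2 := ⟨_, rfl⟩
  obtain ⟨X₀, hX₀⟩ := eventually_atTop.1
    (hlow.and (hinc.and (hdiff (16 * C * R ^ d + 64))))
  filter_upwards [eventually_ge_atTop X₀, eventually_ge_atTop 64] with N hNX hN64 χ h
  have hlow' : ∀ x, N ≤ x → x ^ d ≤ 2 * f x := fun x hx => (hX₀ x (by omega)).1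
  have hinc' : ∀ x, N ≤ x → f x < f (x + 1) := fun x hx => (hX₀ x (by omega)).2.1
  have hdiff' : ∀ x, N ≤ x → (16 * C * R ^ d + 64) * (f (x + 1) - f x) ≤ f x :=
    fun x hx => (hX₀ x (by omega)).2.2
  have hR200 : 200 ≤ R := by nlinarith
  have hRd : 1 ≤ C * R ^ d := by
    have : 1 ≤ R ^ d := one_le_pow₀ (by omega)
    nlinarith
  have hself : ∀ x : ℤ, 1 ≤ x → x ≤ x ^ d := fun x hx => le_self_pow₀ hx (by omega)
  have hdiff64 : ∀ x, N ≤ x → 64 * (f (x + 1) - f x) ≤ f x := fun x hx => by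
    have h1 := hdiff' x hx
    have h2 := hinc' x hx
    have h3 : 0 ≤ C * R ^ d * (f (x + 1) - f x) := mul_nonneg (by omega) (by omega)
    linarith
  have hmono : ∀ x y, N ≤ x → x ≤ y → f x ≤ f y := by
    intro x y hx hxy
    induction y, hxy using Int.leInduction with
    | base => exact le_rfl
    | succ n hn ih => exact ih.trans (hinc' n (by omega)).le
  obtain ⟨V, hV⟩ : ∃ V, V = C * (200 * N) ^ d := ⟨_, rfl⟩
  obtain ⟨V₂, hV₂⟩ : ∃ V₂, V₂ = C * V ^ d := ⟨_, rfl⟩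
  obtain ⟨M, hM⟩ : ∃ M, M = C * V₂ ^ d := ⟨_, rfl⟩
  rw [← hV, ← hV₂, ← hM] at h
  have hgrow : ∀ x : ℤ, 1 ≤ x → x ≤ C * x ^ d := fun x hx => by
    have h1 := hself x hx
    exact h1.trans (le_mul_of_one_le_left (by positivity) hC)
  have hVN : 200 * N ≤ V := by
    have h1 := hgrow (200 * N) (by omega)
    omega
  have hVV : V ≤ V₂ := by rw [hV₂]; exact hgrow V (by omega)
  have hVM : V₂ ≤ M := by rw [hM]; exact hgrow V₂ (by omega)
  -- A bounded ratio `z₂ / z₁` gives `f z₂ ≤ 2 * C * R ^ d * f z₁`, so the factor `16 * C * R ^ d`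
  -- makes the increment at `z₂` at most `f z₁ / 8`.
  have contra : ∀ z₁ z₂, 8 * N ≤ z₁ → z₁ ≤ z₂ → z₂ ≤ R * z₁ → z₂ + 1 ≤ M → f (z₂ + 1) ≤ M →
      χ (z₁ + 1) ≠ χ z₁ → χ z₂ ≠ χ z₁ → χ (z₂ + 1) = χ z₁ → False := by
    intro z₁ z₂ h1 h2 h3 h4 h5 h6 h7 h8
    refine h.false_of_opposite_switches (hpar z₁) (by omega) (by omega) h2 h4 (hinc' _ (by omega))
      (hinc' _ (by omega)) (hmono _ _ (by omega) h2) (hmono _ _ (by omega) (by omega)) h5 ?_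
      h6 h7 h8
    have a1 := hdiff64 z₁ (by omega)
    have a2 := hdiff' z₂ (by omega)
    have a2' := hinc' z₂ (by omega)
    have a3 := hup z₂ (by omega)
    have a4 : z₂ ^ d ≤ (R * z₁) ^ d := pow_le_pow_left₀ (by omega) h3 d
    have a5 := hlow' z₁ (by omega)
    have a6 := hself z₁ (by omega)
    have a7 : f z₂ ≤ C * R ^ d * (2 * f z₁) := by
      calc f z₂ ≤ C * z₂ ^ d := a3
        _ ≤ C * (R * z₁) ^ d := mul_le_mul_of_nonneg_left a4 (by omega)
        _ = C * R ^ d * z₁ ^ d := by rw [mul_pow]; ring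
        _ ≤ C * R ^ d * (2 * f z₁) := mul_le_mul_of_nonneg_left a5 (by omega)
    have a8 : 8 * (f (z₂ + 1) - f z₂) ≤ f z₁ := by
      have : (C * R ^ d) * (8 * (f (z₂ + 1) - f z₂)) ≤ (C * R ^ d) * f z₁ := by linarith
      exact le_of_mul_le_mul_left this (by omega)
    omega
  have hV40 : C * (5 * (8 * N)) ^ d ≤ V := by
    rw [hV]
    exact mul_le_mul_of_nonneg_left (pow_le_pow_left₀ (by omega) (by omega) d) (by omega)
  obtain ⟨x, y, hx, hx', hy, hy', hxy⟩ := h.exists_ne hd hC (u := 8 * N) (by omega) (by omega)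
    (by omega) (fun x hx => hlow' x (by omega)) hup hpar
  have hfub : ∀ x B, 1 ≤ x → x ≤ B → f x ≤ C * B ^ d := fun x B hx hB =>
    (hup x hx).trans (mul_le_mul_of_nonneg_left (pow_le_pow_left₀ (by omega) hB d) (by omega))
  -- For `d = 1`, `f z` need not dominate `2 * z`, so a single change cannot be propagated. Both
  -- colours on each of two adjacent scales give opposite changes, with ratio at most `R`.
  rcases hd.eq_or_lt with rfl | hd2
  · simp only [pow_one] at *
    have hCV : 0 ≤ C * N := by positivity
    have hCV' : V ≤ C * V := le_mul_of_one_le_left (by omega) hC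
    have hCN : C * N ≤ C * (C * N) := le_mul_of_one_le_left hCV hC
    have e1 : V = 200 * (C * N) := by rw [hV]; ring
    have e2 : V₂ = 200 * (C * (C * N)) := by rw [hV₂, hV]; ring
    have e3 : C * (5 * (8 * N)) = 40 * (C * N) := by ring
    have e4 : C * (5 * (40 * (C * N))) = 200 * (C * (C * N)) := by ring
    rw [e3] at hx' hy'
    have hNC : N ≤ C * N := le_mul_of_one_le_left (by omega) hC
    obtain ⟨x₂, y₂, hx₂, hx₂', hy₂, hy₂', hxy₂⟩ := h.exists_ne le_rfl hC (u := 40 * (C * N))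
      (by omega) (by omega) (by rw [pow_one, e4]; omega)
      (fun x hx => by rw [pow_one]; exact hlow' x (by omega))
      (fun x hx => by rw [pow_one]; exact hup x hx) hpar
    rw [pow_one, e4, ← e2] at hx₂' hy₂'
    have pat : ∀ a b, 8 * N ≤ a → a ≤ b → b ≤ 40 * (C * N) → χ b ≠ χ a → False := by
      intro a b ha hab hb hne
      obtain ⟨c, hc, hc', hca⟩ : ∃ c, 40 * (C * N) ≤ c ∧ c ≤ V₂ ∧ χ c = χ a := by
        by_cases hxa : χ x₂ = χ a
        · exact ⟨x₂, hx₂, hx₂', hxa⟩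
        · refine ⟨y₂, hy₂, hy₂', ?_⟩
          by_contra hya
          exact hxy₂ (Fin.eq_of_ne_of_ne_two hxa hya)
      obtain ⟨z₁, z₂, g1, g2, g3, g4, g5, g6⟩ :=
        exists_opposite_switches (χ := χ) hab (hb.trans hc) hne hca
      refine contra z₁ z₂ (by omega) g2 ?_ (by omega) ?_ g4 g5 g6
      · have : R * N ≤ R * z₁ := mul_le_mul_of_nonneg_left (by omega) (by omega)
        have e5 : V₂ = R * N := by rw [e2, hR]; ring
        omega
      · rw [hM]; exact hfub _ _ (by omega) (by omega)
    rcases le_total x y with hle | hle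
    · exact pat x y hx hle hy' hxy.symm
    · exact pat y x hy hle hx' hxy
  · obtain ⟨z, hz, hzV, hzc⟩ : ∃ z, 8 * N ≤ z ∧ z + 1 ≤ V ∧ χ (z + 1) ≠ χ z := by
      rcases le_total x y with hle | hle
      · obtain ⟨z, h1, h2, h3, h4⟩ := exists_switch (χ := χ) hle hxy.symm
        exact ⟨z, by omega, by omega, by rwa [h3]⟩
      · obtain ⟨z, h1, h2, h3, h4⟩ := exists_switch (χ := χ) hle hxy
        exact ⟨z, by omega, by omega, by rwa [h3]⟩
    have b1 := hdiff64 z (by omega)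
    have b2 := hlow' z (by omega)
    have b3 : z ^ 2 ≤ z ^ d := pow_le_pow_right₀ (by omega) hd2
    have b4 : 64 * z ≤ z ^ 2 := by nlinarith
    have b5 := hinc' z (by omega)
    have b6 : f (z + 1) ≤ V₂ := by rw [hV₂]; exact hfub _ _ (by omega) hzV
    obtain ⟨z₁, z₂, g1, g2, g3, g4, g5, g6⟩ := h.exists_opposite_of_switch (z := z) (by omega)
      (by omega) (by omega) b5 (by omega) (by omega) hzc
    refine contra z₁ z₂ (by omega) g2 ?_ (by omega) ?_ g4 g5 g6
    · have : 200 * z₁ ≤ R * z₁ := mul_le_mul_of_nonneg_right hR200 (by omega)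
      omega
    · rw [hM]; exact hfub _ _ (by omega) (by omega)

/-! ### Growth and parity of integer polynomials -/

theorem Polynomial.eventually_eval_pos {P : ℝ[X]} (h : 0 < P.leadingCoeff) :
    ∀ᶠ x in atTop, 0 < P.eval x := by
  rcases le_or_gt P.degree 0 with h0 | h0
  · rw [eq_C_of_degree_le_zero h0] at h ⊢
    exact Eventually.of_forall fun x => by simpa using h
  · exact (P.tendsto_atTop_of_leadingCoeff_nonneg h0 h.le).eventually_gt_atTop 0

theorem Polynomial.eventually_eval_int_pos {P : ℤ[X]} (h : 0 < P.leadingCoeff) :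
    ∀ᶠ x in atTop, 0 < P.eval x := by
  have hinj : Function.Injective (Int.castRingHom ℝ) := Int.cast_injective
  have hlc : 0 < (P.map (Int.castRingHom ℝ)).leadingCoeff := by
    rw [leadingCoeff_map_of_injective hinj]
    simpa using h
  filter_upwards [tendsto_intCast_atTop_atTop.eventually (eventually_eval_pos hlc)] with x hx
  rw [eval_intCast_map] at hx
  simpa using hx

theorem Polynomial.eventually_pow_le_two_mul_eval {p : ℤ[X]} (hlead : 0 < p.leadingCoeff) :
    ∀ᶠ x in atTop, x ^ p.natDegree ≤ 2 * p.eval x := by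
  have hcoeff : (2 * p - X ^ p.natDegree).coeff p.natDegree = 2 * p.leadingCoeff - 1 := by
    rw [coeff_sub, coeff_X_pow_self, coeff_ofNat_mul]
    simp
  have hle : (2 * p - X ^ p.natDegree).natDegree ≤ p.natDegree := by
    refine (natDegree_sub_le _ _).trans (max_le ?_ (by simp))
    exact (natDegree_mul_le).trans (by simp)
  have hpos : 0 < (2 * p - X ^ p.natDegree).leadingCoeff := by
    rw [leadingCoeff, natDegree_eq_of_le_of_coeff_ne_zero hle (by rw [hcoeff]; omega), hcoeff]
    omega
  filter_upwards [eventually_eval_int_pos hpos] with x hx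
  simp only [eval_sub, eval_mul, eval_ofNat, eval_pow, eval_X] at hx
  omega

theorem Polynomial.eventually_mul_eval_succ_sub_le {p : ℤ[X]} (hlead : 0 < p.leadingCoeff) (K : ℤ) :
    ∀ᶠ x in atTop, K * (p.eval (x + 1) - p.eval x) ≤ p.eval x := by
  have hp : p ≠ 0 := by
    rintro rfl
    simp at hlead
  -- The leading terms of `p(X + 1)` and `p` cancel.
  have hlt : (p.comp (X + 1) - p).degree < p.degree := by
    have hX : (X + 1 : ℤ[X]).natDegree = 1 := natDegree_X_add_C 1
    have hXl : (X + 1 : ℤ[X]).leadingCoeff = 1 := leadingCoeff_X_add_C 1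
    have hlc : (p.comp (X + 1)).leadingCoeff = p.leadingCoeff := by
      rw [leadingCoeff_comp (by rw [hX]; exact one_ne_zero), hXl, one_pow, mul_one]
    have hc0 : p.comp (X + 1) ≠ 0 := by
      rw [← leadingCoeff_ne_zero, hlc]
      exact hlead.ne'
    refine degree_sub_lt_right ?_ hp hlc
    rw [degree_eq_natDegree hc0, degree_eq_natDegree hp, natDegree_comp, hX, mul_one]
  have hlt' : (C K * (p.comp (X + 1) - p)).degree < p.degree := by
    rw [← smul_eq_C_mul]
    exact (degree_smul_le _ _).trans_lt hlt
  have hpos : 0 < (p - C K * (p.comp (X + 1) - p)).leadingCoeff := by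
    rwa [leadingCoeff_sub_of_degree_lt hlt']
  filter_upwards [eventually_eval_int_pos hpos] with x hx
  simp only [eval_sub, eval_mul, eval_C, eval_comp, eval_add, eval_X, eval_one] at hx
  linarith

theorem Polynomial.eventually_eval_lt_eval_succ {p : ℤ[X]} (hd : 1 ≤ p.natDegree)
    (hlead : 0 < p.leadingCoeff) : ∀ᶠ x in atTop, p.eval x < p.eval (x + 1) := by
  have hinj : Function.Injective (Int.castRingHom ℝ) := Int.cast_injective
  have hpos : 0 < (p.map (Int.castRingHom ℝ)).derivative.leadingCoeff := by
    rw [leadingCoeff_derivative, leadingCoeff_map_of_injective hinj,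
      natDegree_map_eq_of_injective hinj]
    have h1 : (0 : ℝ) < p.natDegree := by exact_mod_cast hd
    have h2 : (0 : ℝ) < p.leadingCoeff := by exact_mod_cast hlead
    simpa using by positivity
  obtain ⟨A, hA⟩ := eventually_atTop.1 (eventually_eval_pos hpos)
  have hmono : StrictMonoOn (fun x => (p.map (Int.castRingHom ℝ)).eval x) (Set.Ici A) := by
    refine strictMonoOn_of_deriv_pos (convex_Ici A) (Polynomial.continuous _).continuousOn ?_
    intro x hx
    rw [interior_Ici] at hx
    rw [Polynomial.deriv]
    exact hA x (le_of_lt hx)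
  filter_upwards [tendsto_intCast_atTop_atTop.eventually (eventually_ge_atTop A)] with x hx
  have := hmono (a := (x : ℝ)) (b := ((x + 1 : ℤ) : ℝ)) hx
    (hx.trans (by push_cast; linarith)) (by push_cast; linarith)
  simp only [eval_intCast_map] at this
  simpa using this

theorem Polynomial.exists_eval_le_mul_pow (p : ℤ[X]) :
    ∃ C : ℤ, 1 ≤ C ∧ ∀ x, 1 ≤ x → p.eval x ≤ C * x ^ p.natDegree := by
  refine ⟨1 + ∑ i ∈ Finset.range (p.natDegree + 1), |p.coeff i|, ?_, fun x hx => ?_⟩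
  · have : 0 ≤ ∑ i ∈ Finset.range (p.natDegree + 1), |p.coeff i| :=
      Finset.sum_nonneg fun i _ => abs_nonneg _
    omega
  · rw [eval_eq_sum_range, add_mul, Finset.sum_mul]
    have h0 : 0 ≤ 1 * x ^ p.natDegree := by positivity
    refine (Finset.sum_le_sum fun i hi => ?_).trans (le_add_of_nonneg_left h0)
    have hi' : i ≤ p.natDegree := by
      rw [Finset.mem_range] at hi
      omega
    exact mul_le_mul (le_abs_self _) (pow_le_pow_right₀ hx hi') (by positivity) (abs_nonneg _)

theorem Polynomial.even_eval_or_even_eval_succ {p : ℤ[X]} (h : 2 ∣ p.eval 1 * p.eval 2) (x : ℤ) :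
    Even (p.eval x) ∨ Even (p.eval (x + 1)) := by
  have key : ∀ a b : ℤ, Even (a - b) → Even (p.eval b) → Even (p.eval a) := by
    intro a b hab hb
    have h1 : (2 : ℤ) ∣ p.eval a - p.eval b :=
      (even_iff_two_dvd.1 hab).trans (sub_dvd_eval_sub a b p)
    have := (even_iff_two_dvd.2 h1).add hb
    simpa using this
  rcases Int.prime_two.dvd_or_dvd h with h | h <;> rw [← even_iff_two_dvd] at h <;>
    rcases Int.even_or_odd' x with ⟨k, hk | hk⟩
  · exact Or.inr (key _ 1 ⟨k, by omega⟩ h)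
  · exact Or.inl (key _ 1 ⟨k, by omega⟩ h)
  · exact Or.inl (key _ 2 ⟨k - 1, by omega⟩ h)
  · exact Or.inr (key _ 2 ⟨k, by omega⟩ h)

/-! ### Upper bound on real intervals -/

theorem hasMonoSolution_of_not_isSolutionFree {p : ℤ[X]} {N M : ℤ} (hN : 0 ≤ N) {a b : ℝ}
    (ha : a ≤ N) (hb : (M : ℝ) ≤ b) (h : ∀ χ, ¬ IsSolutionFree (fun x => p.eval x) N M χ)
    (φ : natInterval a b → Fin 2) : HasMonoSolution p φ := by
  classical
  have hmem : ∀ x : ℤ, N ≤ x → x ≤ M → x.toNat ∈ natInterval a b := by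
    intro x hx hx'
    have e : ((x.toNat : ℕ) : ℝ) = (x : ℝ) := by
      exact_mod_cast congrArg (Int.cast : ℤ → ℝ) (Int.toNat_of_nonneg (hN.trans hx))
    constructor <;> rw [e]
    · exact ha.trans (by exact_mod_cast hx)
    · exact le_trans (by exact_mod_cast hx') hb
  by_contra hno
  -- The default colour 0 is never tested: `[N, M]` lies inside `natInterval a b`.
  refine h (fun x => if hx : x.toNat ∈ natInterval a b then φ ⟨x.toNat, hx⟩ else 0) ?_
  intro x y z hx hx' hy hy' hz hz' hxyz hcxy hcyz
  simp only [dif_pos (hmem x hx hx'), dif_pos (hmem y hy hy'), dif_pos (hmem z hz hz')]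
    at hcxy hcyz
  refine hno ⟨_, _, _, hcxy, hcyz, ?_⟩
  simp only [Int.toNat_of_nonneg (hN.trans hx), Int.toNat_of_nonneg (hN.trans hy),
    Int.toNat_of_nonneg (hN.trans hz)]
  exact hxyz

theorem exists_tendsto_hasMonoSolution {p : ℤ[X]} (hd : 1 ≤ p.natDegree)
    (hlead : 0 < p.leadingCoeff) (hpar : 2 ∣ p.eval 1 * p.eval 2) :
    ∃ ε : ℕ → ℝ, Tendsto ε atTop (𝓝 0) ∧ ∀ᶠ N : ℕ in atTop,
      ∀ φ : natInterval (N : ℝ) ((N : ℝ) ^ ((p.natDegree : ℝ) ^ 3 + ε N)) → Fin 2,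
        HasMonoSolution p φ := by
  obtain ⟨C, hC, hup⟩ := p.exists_eval_le_mul_pow
  set d := p.natDegree with hddef
  have main := exists_not_isSolutionFree (f := fun x => p.eval x) hd hC
    (eventually_pow_le_two_mul_eval hlead) hup (eventually_eval_lt_eval_succ hd hlead)
    (eventually_mul_eval_succ_sub_le hlead) (even_eval_or_even_eval_succ hpar)
  obtain ⟨A, hA⟩ : ∃ A : ℤ, A = C * (C * (C * 200 ^ d) ^ d) ^ d := ⟨_, rfl⟩
  have hA0 : 0 < A := by rw [hA]; positivity
  -- Chosen so that `N ^ ε N = A` absorbs the constant factor.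
  refine ⟨fun N => Real.log A / Real.log N, ?_, ?_⟩
  · exact tendsto_const_nhds.div_atTop (Real.tendsto_log_atTop.comp tendsto_natCast_atTop_atTop)
  · filter_upwards [tendsto_natCast_atTop_atTop.eventually main, eventually_ge_atTop 2]
      with N hN hN2
    have hN1 : (1 : ℝ) < N := by exact_mod_cast hN2
    refine hasMonoSolution_of_not_isSolutionFree (N := N) (by positivity) (by simp) ?_ hN
    have e1 : C * (C * (C * (200 * (N : ℤ)) ^ d) ^ d) ^ d = A * (N : ℤ) ^ (d ^ 3) := by
      rw [hA]
      simp only [mul_pow, ← pow_mul]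
      ring
    have hlog : Real.log N ≠ 0 := (Real.log_pos hN1).ne'
    have hAr : (0 : ℝ) < A := by exact_mod_cast hA0
    have e2 : (N : ℝ) ^ (Real.log A / Real.log N) = A := by
      rw [Real.rpow_def_of_pos (by linarith), mul_div_cancel₀ _ hlog, Real.exp_log hAr]
    have e3 : (N : ℝ) ^ ((d : ℝ) ^ 3) = (N : ℝ) ^ (d ^ 3) := by
      rw [← Nat.cast_pow, Real.rpow_natCast]
    rw [e1, Real.rpow_add (by linarith), e2, e3]
    push_cast
    rw [mul_comm]

/-! ### The colouring for the lower bound -/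

theorem exists_not_hasMonoSolution {p : ℤ[X]} (hlead : 0 < p.leadingCoeff) :
    ∃ c : ℝ, 0 < c ∧ ∀ N : ℕ, 1 ≤ N →
      ∃ φ : natInterval (N : ℝ) (c * (N : ℝ) ^ (p.natDegree ^ 2)) → Fin 2,
        ¬ HasMonoSolution p φ := by
  classical
  obtain ⟨X₀, hX₀⟩ := eventually_atTop.1 (eventually_pow_le_two_mul_eval hlead)
  set d := p.natDegree with hddef
  obtain ⟨B, hB⟩ : ∃ B : ℕ, X₀ ≤ B := ⟨X₀.toNat, Int.self_le_toNat X₀⟩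
  have hlow : ∀ N z : ℕ, B ≤ N → N ≤ z → (z : ℝ) ^ d ≤ 2 * ((p.eval (z : ℤ) : ℤ) : ℝ) := by
    intro N z h1 h2
    have := hX₀ z (hB.trans (by exact_mod_cast h1.trans h2))
    exact_mod_cast this
  have hB1 : (1 : ℝ) ≤ ((B : ℝ) + 1) ^ (d ^ 2) := one_le_pow₀ (by linarith [B.cast_nonneg (α := ℝ)])
  have h4 : (1 : ℝ) ≤ 4 ^ d := one_le_pow₀ (by norm_num)
  -- The factor in `B` empties the interval when `N < B`; `8 * 4 ^ d` keeps `x + y` below `p(z)`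
  -- when `z ≥ N ^ d / 4`.
  refine ⟨1 / (8 * 4 ^ d * ((B : ℝ) + 1) ^ (d ^ 2)), by positivity, fun N hN => ?_⟩
  set c : ℝ := 1 / (8 * 4 ^ d * ((B : ℝ) + 1) ^ (d ^ 2)) with hc
  have hN1 : (1 : ℝ) ≤ N := by exact_mod_cast hN
  have hNpos : (0 : ℝ) < (N : ℝ) ^ (d ^ 2) := by positivity
  refine ⟨fun n => if ((n : ℕ) : ℝ) < (N : ℝ) ^ d / 4 then 0 else 1, ?_⟩
  rintro ⟨⟨x, hx, hx'⟩, ⟨y, hy, hy'⟩, ⟨z, hz, hz'⟩, hxy, hyz, hsum⟩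
  have hsum' : (x : ℝ) + y = ((p.eval (z : ℤ) : ℤ) : ℝ) := by exact_mod_cast hsum
  rcases lt_or_ge N B with hNB | hNB
  · have h1 : (N : ℝ) ^ (d ^ 2) ≤ ((B : ℝ) + 1) ^ (d ^ 2) := by
      have : (N : ℝ) < B := by exact_mod_cast hNB
      exact pow_le_pow_left₀ (by positivity) (by linarith) _
    have h2 : c * (N : ℝ) ^ (d ^ 2) < 1 := by
      rw [hc, div_mul_eq_mul_div, one_mul, div_lt_one (by positivity)]
      nlinarith
    linarith
  · have hzl := hlow N z hNB (by exact_mod_cast hz)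
    simp only at hxy hyz
    by_cases hzs : (z : ℝ) < (N : ℝ) ^ d / 4
    · have hys : (y : ℝ) < (N : ℝ) ^ d / 4 := by
        by_contra hcon
        simp [hzs, hcon] at hyz
      have hxs : (x : ℝ) < (N : ℝ) ^ d / 4 := by
        by_contra hcon
        simp [hys, hcon] at hxy
      have : (N : ℝ) ^ d ≤ (z : ℝ) ^ d := pow_le_pow_left₀ (by positivity) hz d
      linarith
    · have h1 : ((N : ℝ) ^ d / 4) ^ d ≤ (z : ℝ) ^ d :=
        pow_le_pow_left₀ (by positivity) (not_lt.1 hzs) d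
      have h2 : ((N : ℝ) ^ d / 4) ^ d = (N : ℝ) ^ (d ^ 2) / 4 ^ d := by
        rw [div_pow, ← pow_mul, sq]
      have h3 : c * (N : ℝ) ^ (d ^ 2) ≤ (N : ℝ) ^ (d ^ 2) / 4 ^ d / 8 := by
        have : c ≤ 1 / (8 * 4 ^ d) := by
          rw [hc]
          exact one_div_le_one_div_of_le (by positivity) (le_mul_of_one_le_right (by positivity) hB1)
        calc c * (N : ℝ) ^ (d ^ 2) ≤ 1 / (8 * 4 ^ d) * (N : ℝ) ^ (d ^ 2) :=
              mul_le_mul_of_nonneg_right this hNpos.le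
          _ = (N : ℝ) ^ (d ^ 2) / 4 ^ d / 8 := by field_simp
      have h5 : 0 < (N : ℝ) ^ (d ^ 2) / 4 ^ d := by positivity
      linarith

theorem theorem5p1 (p : ℤ[X]) (d : ℕ) (hdeg : p.natDegree = d) (hd : 1 ≤ d)
    (hlead : 0 < p.leadingCoeff) (hpar : 2 ∣ p.eval 1 * p.eval 2) :
    (∃ ε : ℕ → ℝ, Tendsto ε atTop (𝓝 0) ∧
      ∀ᶠ N : ℕ in atTop,
        ∀ φ : natInterval (N : ℝ) ((N : ℝ) ^ ((d : ℝ) ^ 3 + ε N)) → Fin 2,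
          HasMonoSolution p φ) ∧
    (∃ c : ℝ, 0 < c ∧
      ∀ N : ℕ, 1 ≤ N →
        ∃ φ : natInterval (N : ℝ) (c * (N : ℝ) ^ (d ^ 2)) → Fin 2,
          ¬ HasMonoSolution p φ) := by
  subst hdeg
  exact ⟨exists_tendsto_hasMonoSolution hd hlead hpar, exists_not_hasMonoSolution hlead⟩
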